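/- Let $q\ge 1$ be an integer and $\mathbb T^q=\mathbb R^q/(2\pi\mathbb Z)^q$, with the distance $|\mathbf x-\mathbf y|=\max_{1\le i\le q}|(x_i-y_i)\bmod 2\pi|$, where $|t \bmod 2\pi|$ denotes the distance from $t$ to $2\pi\mathbb Z$. Let $\|\cdot\|$ be the supremum norm on $\mathbb T^q$. For a continuously differentiable function $g$ on $\mathbb T^q$ put $\|g\|_{W^*}=\sum_{j=1}^q\|D_jg\|$, where $D_j$ is the $j$-th partial derivative. For real $N>0$ let $$\mathbb H_N^q=\mathrm{span}_{\mathbb C}\{\mathbf x\mapsto\exp(i\mathbf k\cdot \mathbf x):\mathbf k\in\mathbb Z^q,\ |\mathbf k|_2<N\}.$$ There is a constant $c>0$, depending only on $q$, such that the following holds for every real $B>0$. Let $f:\mathbb T^q\to\mathbb R$ be continuously differentiable, let $M\ge 1$, let $\mathbf x_1,\dots,\mathbf x_M\in\mathbb T^q$ be distinct, and let $y_j=f(\mathbf x_j)+\epsilon_j$ with $\epsilon_j\in\mathbb R$ and $\epsilon=\max_{1\le j\le M}|\epsilon_j|$. Let $\eta(\mathcal C)=\min_{j\ne k}|\mathbf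 x_j-\mathbf x_k|$ be the minimal separation of $\mathcal C=\{\mathbf x_1,\dots,\mathbf x_M\}$ (with $\eta(\mathcal C)=\infty$ if $M=1$), and let $N>0$ be a real number with $N\ge B\,\eta(\mathcal C)^{-1}$. Then the functional $$R_N(T)=\max_{1\le j\le M}|y_j-T(\mathbf x_j)|+\frac1N\|T\|_{W^*}$$ has a minimizer over $T\in\mathbb H_N^q$, and every minimizer $T^*$ satisfies $$\max_{1\le j\le M}|y_j-T^*(\mathbf x_j)|\le \min_{T\in\mathbb H_N^q}R_N(T)\le c\left\{\epsilon+\frac1N\|f\|_{W^*}\right\}$$ and, for every $\mathbf x\in\mathbb T^q$ with $\delta=\min_{1\le j\le M}|\mathbf x-\mathbf x_j|$, $$|f(\mathbf x)-T^*(\mathbf x)|\le c(1+N\delta)\left\{\epsilon+\frac1N\|f\|_{W^*}\right\}.$$ -/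

import Mathlib

open Real

noncomputable section

/-- The `q`-dimensional torus `ℝ^q / (2πℤ)^q`. The distance that Mathlib puts on this type is
`dist x y = max_i |(x_i - y_i) mod 2π|`, where `|t mod 2π|` is the distance from `t` to `2πℤ`. -/
abbrev Torus (q : ℕ) : Type := Fin q → AddCircle (2 * π)

namespace Torus

/-- The quotient map `ℝ^q → 𝕋^q`. -/
def proj {q : ℕ} (t : Fin q → ℝ) : Torus q := fun i => (t i : AddCircle (2 * π))

/-- The supremum norm of a (bounded) function on the torus. -/
def supNorm {q : ℕ} {E : Type*} [NormedAddCommGroup E] (g : Torus q → E) : ℝ :=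
  ⨆ x, ‖g x‖

/-- The partial derivative `D_j g` of a function on the torus. -/
def partialDeriv {q : ℕ} {E : Type*} [NormedAddCommGroup E] [NormedSpace ℝ E]
    (j : Fin q) (g : Torus q → E) : Torus q → E :=
  fun x => deriv (fun s : ℝ => g (x + Pi.single j (s : AddCircle (2 * π)))) 0

/-- `g ∈ W^*`: the function `g` on the torus is continuously differentiable, that is, the
corresponding `2π`-periodic function on `ℝ^q` is. -/
def IsC1 {q : ℕ} {E : Type*} [NormedAddCommGroup E] [NormedSpace ℝ E]
    (g : Torus q → E) : Prop :=
  ContDiff ℝ 1 (fun t : Fin q → ℝ => g (proj t))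

/-- `‖g‖_{W^*} = ∑_j ‖D_j g‖`, with supremum norms on the right. -/
def wNorm {q : ℕ} {E : Type*} [NormedAddCommGroup E] [NormedSpace ℝ E]
    (g : Torus q → E) : ℝ :=
  ∑ j, supNorm (partialDeriv j g)

/-- The exponential `x ↦ exp(i k·x)` on the torus. -/
def expMonomial {q : ℕ} (k : Fin q → ℤ) : Torus q → ℂ :=
  fun x => ∏ j, fourier (k j) (x j)

theorem expMonomial_proj {q : ℕ} (k : Fin q → ℤ) (t : Fin q → ℝ) :
    expMonomial k (proj t) = Complex.exp (Complex.I * ∑ j, (k j : ℂ) * (t j : ℂ)) := by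
  simp only [expMonomial, proj, fourier_coe_apply, Finset.mul_sum, Complex.exp_sum]
  refine Finset.prod_congr rfl fun j _ => ?_
  congr 1
  have : (π : ℂ) ≠ 0 := by exact_mod_cast Real.pi_ne_zero
  push_cast
  field_simp

/-- `ℍ_N^q`: the trigonometric polynomials of spherical degree `< N`, i.e. the complex span of
the exponentials `exp(i k·x)` with `|k|_2 < N`. -/
def trigPoly (q : ℕ) (N : ℝ) : Submodule ℂ (Torus q → ℂ) :=
  Submodule.span ℂ (expMonomial '' {k : Fin q → ℤ | √(∑ j, (k j : ℝ) ^ 2) < N})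

/-- `max_j |y_j - T(x_j)|`, the training error of `T` on the data `(x_j, y_j)`. -/
def trainingError {q M : ℕ} (x : Fin M → Torus q) (y : Fin M → ℝ) (T : Torus q → ℂ) : ℝ :=
  ⨆ j, ‖(y j : ℂ) - T (x j)‖

/-- The regularization functional `R_N(T) = max_j |y_j - T(x_j)| + (1/N) ‖T‖_{W^*}`. -/
def regFunctional {q M : ℕ} (x : Fin M → Torus q) (y : Fin M → ℝ) (N : ℝ)
    (T : Torus q → ℂ) : ℝ :=
  trainingError x y T + (1 / N) * wNorm T

end Torus

end

/-!
The separation hypothesis plays no role: everything follows from a Jackson-type theorem and the mean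
value inequality, with a constant depending on `q` alone.

*Approximation.* For every `N > 0` there is `S ∈ ℍ_N^q` with `‖f - S‖ ≤ C √q ‖f‖_{W^*} / N` and
`‖S‖_{W^*} ≤ ‖f‖_{W^*}` (`exists_trigPoly_approx`). It is the convolution of `f` with a tensor
product of one-dimensional Fejér-Korovkin kernels `K = |∑_{k < n} a_k exp (i k t)|² / ∑ a_k²`,
`a_k = sin (π (k + 1) / (n + 1))`, with `n` about `N / √q`. The recurrence
`a_{k - 1} + a_{k + 1} = 2 cos (π / (n + 1)) a_k` gives `∫ cos t K(t) = cos (π / (n + 1))`, hence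
`∫ ‖t‖² K = O(1 / n²)` and `∫ ‖t‖ K = O(1 / n)` (`exists_kernel`). As `K ≥ 0` has mean `1`, the
convolution preserves directional Lipschitz bounds, and with them the bound on the `W^*` norm.
Inserting `S` into `R_N` bounds its minimum by a multiple of `ε + ‖f‖_{W^*} / N`.

*Existence of a minimizer.* With the topology of pointwise convergence on the finite-dimensional
space `ℍ_N^q`, the functional `R_N` is lower semicontinuous and its sublevel sets lie in compact sets
(`exists_isMinOn_regFunctional`).

*Error bound.* Both `f` and a minimizer `T` are Lipschitz, with constants `‖f‖_{W^*}` and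
`‖T‖_{W^*} ≤ N R_N(T)` (`IsC1.norm_sub_le`), so the error at a nearest data point propagates to `z`.
-/

namespace Torus

/-! ### Partial derivatives and Lipschitz bounds -/

section Lipschitz

variable {q : ℕ} {E : Type*} [NormedAddCommGroup E] [NormedSpace ℝ E] {g : Torus q → E}

lemma exists_coe_eq_abs_eq_norm (u : AddCircle (2 * π)) :
    ∃ s : ℝ, (s : AddCircle (2 * π)) = u ∧ |s| = ‖u‖ ∧ |s| ≤ π := by
  obtain ⟨t, rfl⟩ := QuotientAddGroup.mk_surjective u
  have h2π : (2 * π) ≠ 0 := Real.two_pi_pos.ne'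
  have hs : ((t - round ((2 * π)⁻¹ * t) * (2 * π) : ℝ) : AddCircle (2 * π)) = t := by
    rw [AddCircle.coe_sub, sub_eq_self, ← zsmul_eq_mul, AddCircle.coe_zsmul, AddCircle.coe_period,
      smul_zero]
  refine ⟨_, hs, (AddCircle.norm_eq (2 * π)).symm, ?_⟩
  rw [← AddCircle.norm_eq (2 * π)]
  refine (AddCircle.norm_le_half_period (2 * π) h2π).trans_eq ?_
  rw [abs_of_pos Real.two_pi_pos]
  ring

lemma exists_proj_eq (x : Torus q) : ∃ t ∈ Set.Icc (fun _ : Fin q => -π) (fun _ => π),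
    proj t = x := by
  choose s hs _ hs' using fun i => exists_coe_eq_abs_eq_norm (x i)
  exact ⟨s, ⟨fun i => (abs_le.1 (hs' i)).1, fun i => (abs_le.1 (hs' i)).2⟩, funext hs⟩

lemma proj_add_single (t : Fin q → ℝ) (j : Fin q) (s : ℝ) :
    proj (t + s • Pi.single j 1) = proj t + Pi.single j (s : AddCircle (2 * π)) := by
  ext i
  rcases eq_or_ne i j with rfl | h
  · simp [proj]
  · simp [proj, h]

lemma IsC1.hasDerivAt_proj (hg : IsC1 g) (t : Fin q → ℝ) (j : Fin q) :
    HasDerivAt (fun s : ℝ => g (proj t + Pi.single j (s : AddCircle (2 * π))))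
      (fderiv ℝ (fun t => g (proj t)) t (Pi.single j 1)) 0 := by
  have h := ((hg.differentiable one_ne_zero) t).hasFDerivAt.hasLineDerivAt (Pi.single j 1)
  simpa only [HasLineDerivAt, proj_add_single] using h

lemma IsC1.partialDeriv_proj (hg : IsC1 g) (t : Fin q → ℝ) (j : Fin q) :
    partialDeriv j g (proj t) = fderiv ℝ (fun t => g (proj t)) t (Pi.single j 1) :=
  (hg.hasDerivAt_proj t j).deriv

/-- Moving `x` in the `j`-th direction, `g` has derivative `D_j g` at every parameter. -/
lemma IsC1.hasDerivAt (hg : IsC1 g) (x : Torus q) (j : Fin q) (s : ℝ) :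
    HasDerivAt (fun s : ℝ => g (x + Pi.single j (s : AddCircle (2 * π))))
      (partialDeriv j g (x + Pi.single j (s : AddCircle (2 * π)))) s := by
  obtain ⟨t, -, ht⟩ := exists_proj_eq (x + Pi.single j (s : AddCircle (2 * π)))
  have h := hg.hasDerivAt_proj t j
  rw [← hg.partialDeriv_proj, ht] at h
  have h' := HasDerivAt.scomp_of_eq s h ((hasDerivAt_id s).sub_const s) (by simp)
  rw [one_smul] at h'
  refine h'.congr_of_eventuallyEq (Filter.Eventually.of_forall fun r => ?_)
  simp only [Function.comp, id]
  rw [add_assoc, ← Pi.single_add, ← AddCircle.coe_add, add_sub_cancel]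

lemma IsC1.bddAbove_range_norm_partialDeriv (hg : IsC1 g) (j : Fin q) :
    BddAbove (Set.range fun x => ‖partialDeriv j g x‖) := by
  have hc : Continuous fun t => ‖fderiv ℝ (fun t => g (proj t)) t (Pi.single j 1)‖ :=
    ((hg.continuous_fderiv one_ne_zero).clm_apply continuous_const).norm
  obtain ⟨C, hC⟩ := (isCompact_Icc.image hc).bddAbove
  refine ⟨C, ?_⟩
  rintro _ ⟨x, rfl⟩
  obtain ⟨t, ht, rfl⟩ := exists_proj_eq x
  exact hC ⟨t, ht, by simp only [hg.partialDeriv_proj]⟩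

lemma supNorm_nonneg {E : Type*} [NormedAddCommGroup E] (g : Torus q → E) : 0 ≤ supNorm g :=
  Real.iSup_nonneg fun _ => norm_nonneg _

lemma wNorm_nonneg (g : Torus q → E) : 0 ≤ wNorm g :=
  Finset.sum_nonneg fun _ _ => supNorm_nonneg _

lemma IsC1.norm_partialDeriv_le (hg : IsC1 g) (j : Fin q) (x : Torus q) :
    ‖partialDeriv j g x‖ ≤ supNorm (partialDeriv j g) :=
  le_ciSup (hg.bddAbove_range_norm_partialDeriv j) x

lemma IsC1.norm_add_single_sub_le (hg : IsC1 g) (x : Torus q) (j : Fin q)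
    (u : AddCircle (2 * π)) :
    ‖g (x + Pi.single j u) - g x‖ ≤ supNorm (partialDeriv j g) * ‖u‖ := by
  obtain ⟨s, rfl, hs, -⟩ := exists_coe_eq_abs_eq_norm u
  have h := convex_univ.norm_image_sub_le_of_norm_deriv_le
    (fun r _ => (hg.hasDerivAt x j r).differentiableAt)
    (fun r _ => by rw [(hg.hasDerivAt x j r).deriv]; exact hg.norm_partialDeriv_le j _)
    (Set.mem_univ 0) (Set.mem_univ s)
  rw [← hs]
  simpa using h

/-- The increment of `g` is controlled coordinate by coordinate. -/
lemma IsC1.norm_add_sub_le (hg : IsC1 g) (x u : Torus q) :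
    ‖g (x + u) - g x‖ ≤ ∑ j, supNorm (partialDeriv j g) * ‖u j‖ := by
  have key (s : Finset (Fin q)) : ‖g (x + ∑ j ∈ s, Pi.single j (u j)) - g x‖ ≤
      ∑ j ∈ s, supNorm (partialDeriv j g) * ‖u j‖ := by
    induction s using Finset.induction_on with
    | empty => simp
    | insert j s hj ih =>
      rw [Finset.sum_insert hj, Finset.sum_insert hj]
      refine (norm_sub_le_norm_sub_add_norm_sub _ (g (x + ∑ j ∈ s, Pi.single j (u j))) _).trans
        (add_le_add ?_ ih)
      rw [add_comm (Pi.single j (u j) : Torus q), ← add_assoc]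
      exact hg.norm_add_single_sub_le _ j _
  simpa only [Finset.univ_sum_single] using key Finset.univ

lemma IsC1.norm_sub_le (hg : IsC1 g) (x z : Torus q) :
    ‖g z - g x‖ ≤ dist z x * wNorm g := by
  have h := hg.norm_add_sub_le x (z - x)
  rw [add_sub_cancel] at h
  refine h.trans ?_
  rw [wNorm, Finset.mul_sum]
  refine Finset.sum_le_sum fun j _ => ?_
  rw [mul_comm, dist_eq_norm]
  exact mul_le_mul_of_nonneg_right (norm_le_pi_norm (z - x) j) (supNorm_nonneg _)

lemma IsC1.continuous (hg : IsC1 g) : Continuous g := by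
  refine (LipschitzWith.of_dist_le_mul (K := ⟨wNorm g, wNorm_nonneg g⟩) fun z x => ?_).continuous
  rw [dist_eq_norm, mul_comm]
  exact hg.norm_sub_le x z

/-- A directional Lipschitz constant bounds the partial derivative. -/
lemma supNorm_partialDeriv_le {j : Fin q} {C : ℝ} (hC : 0 ≤ C)
    (h : ∀ x (u : AddCircle (2 * π)), ‖g (x + Pi.single j u) - g x‖ ≤ C * ‖u‖) :
    supNorm (partialDeriv j g) ≤ C := by
  refine ciSup_le fun x => norm_deriv_le_of_lip' hC (Filter.Eventually.of_forall fun s => ?_)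
  simp only [AddCircle.coe_zero, Pi.single_zero, add_zero, sub_zero]
  refine (h x s).trans (mul_le_mul_of_nonneg_left ?_ hC)
  exact QuotientAddGroup.norm_mk_le_norm

end Lipschitz

/-! ### The one-dimensional Fejér-Korovkin kernel -/

section Kernel

open MeasureTheory AddCircle

instance fact_two_pi_pos : Fact (0 < 2 * π) := ⟨Real.two_pi_pos⟩

lemma integral_fourier (m : ℤ) :
    ∫ t : AddCircle (2 * π), fourier m t ∂haarAddCircle = if m = 0 then 1 else 0 := by
  have h := congrFun (fourierCoeff_fourier (T := 2 * π) m) 0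
  simpa [fourierCoeff, Pi.single_apply, eq_comm] using h

lemma integrable_of_continuous {E : Type*} [NormedAddCommGroup E] {g : AddCircle (2 * π) → E}
    (hg : Continuous g) : Integrable g haarAddCircle :=
  hg.integrable_of_hasCompactSupport (HasCompactSupport.of_compactSpace g)

lemma sq_norm_le_one_sub_re_fourier (u : AddCircle (2 * π)) :
    ‖u‖ ^ 2 ≤ π ^ 2 / 2 * (1 - (fourier 1 u).re) := by
  obtain ⟨s, rfl, hs, hsπ⟩ := exists_coe_eq_abs_eq_norm u
  have hre : (fourier 1 (s : AddCircle (2 * π))).re = cos s := by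
    rw [fourier_coe_apply]
    have : 2 * (π : ℂ) * Complex.I * (1 : ℤ) * s / ((2 * π : ℝ) : ℂ) = s * Complex.I := by
      have : (π : ℂ) ≠ 0 := by exact_mod_cast Real.pi_ne_zero
      push_cast
      field_simp
    rw [this, Complex.exp_ofReal_mul_I_re]
  rw [hre, ← hs, sq_abs]
  have h := cos_le_one_sub_mul_cos_sq hsπ
  have hπ : 0 < π ^ 2 / 2 := by positivity
  calc s ^ 2 = π ^ 2 / 2 * (2 / π ^ 2 * s ^ 2) := by field_simp
    _ ≤ _ := mul_le_mul_of_nonneg_left (by linarith) hπ.le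

/-- The coefficients `sin (π (k + 1) / (n + 1))`, `0 ≤ k < n`, which maximize
`∑ a_k a_{k + 1}` relative to `∑ a_k²`, so that the square modulus of their trigonometric polynomial
concentrates at `0`. -/
noncomputable def sineCoeff (n k : ℕ) : ℝ := sin (π * (k + 1) / (n + 1))

/-- The trigonometric polynomial `∑_{k < n} sin (π (k + 1) / (n + 1)) exp (i k t)`. -/
noncomputable def sinePoly (n : ℕ) (t : AddCircle (2 * π)) : ℂ :=
  ∑ k ∈ Finset.range n, (sineCoeff n k : ℂ) * fourier (k : ℤ) t

lemma continuous_sinePoly (n : ℕ) : Continuous (sinePoly n) :=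
  continuous_finsetSum _ fun _ _ => continuous_const.mul (map_continuous _)

lemma sq_norm_sinePoly (n : ℕ) (t : AddCircle (2 * π)) :
    ((‖sinePoly n t‖ ^ 2 : ℝ) : ℂ) = ∑ p ∈ Finset.range n ×ˢ Finset.range n,
      ((sineCoeff n p.1 * sineCoeff n p.2 : ℝ) : ℂ) * fourier ((p.1 : ℤ) - p.2) t := by
  rw [Complex.ofReal_pow, ← Complex.mul_conj', sinePoly, map_sum, Finset.sum_mul_sum,
    ← Finset.sum_product']
  refine Finset.sum_congr rfl fun p _ => ?_
  rw [map_mul, Complex.conj_ofReal, ← fourier_neg, sub_eq_add_neg, fourier_add]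
  push_cast
  ring

lemma integral_fourier_mul_sq_norm_sinePoly (n : ℕ) (m : ℤ) :
    ∫ t, fourier m t * ((‖sinePoly n t‖ ^ 2 : ℝ) : ℂ) ∂haarAddCircle =
      ((∑ k ∈ Finset.range n, ∑ l ∈ Finset.range n,
        if (l : ℤ) = k + m then sineCoeff n k * sineCoeff n l else 0 : ℝ) : ℂ) := by
  simp_rw [sq_norm_sinePoly, Finset.mul_sum]
  rw [integral_finsetSum _ fun p _ => integrable_of_continuous (by fun_prop),
    Finset.sum_product, Complex.ofReal_sum]
  refine Finset.sum_congr rfl fun k _ => ?_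
  rw [Complex.ofReal_sum]
  refine Finset.sum_congr rfl fun l _ => ?_
  have (t : AddCircle (2 * π)) : fourier m t *
      (((sineCoeff n k * sineCoeff n l : ℝ) : ℂ) * fourier ((k : ℤ) - l) t) =
      ((sineCoeff n k * sineCoeff n l : ℝ) : ℂ) * fourier (m + (k - l)) t := by
    rw [fourier_add (m := m)]
    ring
  simp_rw [this]
  rw [integral_const_mul, integral_fourier]
  have : m + ((k : ℤ) - l) = 0 ↔ (l : ℤ) = k + m := by constructor <;> intro <;> linarith
  simp only [this]
  split_ifs <;> simp

lemma integral_sq_norm_sinePoly (n : ℕ) :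
    ∫ t, ‖sinePoly n t‖ ^ 2 ∂haarAddCircle = ∑ k ∈ Finset.range n, sineCoeff n k ^ 2 := by
  have h := integral_fourier_mul_sq_norm_sinePoly n 0
  simp only [fourier_zero, one_mul] at h
  rw [integral_complex_ofReal] at h
  rw [Complex.ofReal_inj.1 h]
  refine Finset.sum_congr rfl fun k hk => ?_
  simp only [add_zero, Nat.cast_inj, Finset.sum_ite_eq', hk, if_true]
  ring

/-- The eigenvalue relation behind the choice of coefficients: the first Fourier coefficient of
`|sinePoly n|²` is `cos (π / (n + 1))` times the zeroth. -/
lemma integral_re_fourier_mul_sq_norm_sinePoly (n : ℕ) :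
    ∫ t, (fourier 1 t).re * ‖sinePoly n t‖ ^ 2 ∂haarAddCircle =
      cos (π / (n + 1)) * ∑ k ∈ Finset.range n, sineCoeff n k ^ 2 := by
  have h := integral_fourier_mul_sq_norm_sinePoly n 1
  have hint : Integrable (fun t => fourier 1 t * ((‖sinePoly n t‖ ^ 2 : ℝ) : ℂ))
      (haarAddCircle (T := 2 * π)) :=
    integrable_of_continuous ((map_continuous _).mul
      (Complex.continuous_ofReal.comp ((continuous_sinePoly n).norm.pow 2)))
  have h1 : ∫ t, (fourier 1 t).re * ‖sinePoly n t‖ ^ 2 ∂haarAddCircle =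
      (∫ t, fourier 1 t * ((‖sinePoly n t‖ ^ 2 : ℝ) : ℂ) ∂haarAddCircle (T := 2 * π)).re := by
    have := integral_re hint
    simp only [RCLike.re_eq_complex_re, Complex.re_mul_ofReal] at this
    exact this
  rw [h1, h, Complex.ofReal_re]
  have hn : (n : ℝ) + 1 ≠ 0 := by positivity
  -- the coefficients extended by `0` on both sides, as `s (k + 1) = sineCoeff n k`
  set s : ℕ → ℝ := fun k => sin (π * k / (n + 1)) with hs
  have ha (k : ℕ) : sineCoeff n k = s (k + 1) := by simp [sineCoeff, hs]
  have hs0 : s 0 = 0 := by simp [hs]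
  have hsn : s (n + 1) = 0 := by
    simp only [hs, Nat.cast_add, Nat.cast_one, mul_div_cancel_right₀ _ hn, sin_pi]
  have hsum : ∑ k ∈ Finset.range n, ∑ l ∈ Finset.range n,
      (if (l : ℤ) = k + 1 then sineCoeff n k * sineCoeff n l else 0) =
      ∑ k ∈ Finset.range n, s (k + 1) * s (k + 2) := by
    refine Finset.sum_congr rfl fun k hk => ?_
    have (l : ℕ) : (l : ℤ) = k + 1 ↔ l = k + 1 := by omega
    simp only [this, Finset.sum_ite_eq', ha]
    split_ifs with hk'
    · rfl
    · have : k + 1 = n := by simp only [Finset.mem_range] at hk hk'; omega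
      rw [show k + 2 = n + 1 by omega, hsn, mul_zero]
  have hshift : ∑ k ∈ Finset.range n, s (k + 1) * s (k + 2) =
      ∑ k ∈ Finset.range n, s k * s (k + 1) := by
    have h1 := Finset.sum_range_succ (fun k => s k * s (k + 1)) n
    have h2 := Finset.sum_range_succ' (fun k => s k * s (k + 1)) n
    simp only [hsn, hs0, mul_zero, zero_mul, add_zero] at h1 h2
    rw [← h1, h2]
  have hrec (k : ℕ) : s k + s (k + 2) = 2 * cos (π / (n + 1)) * s (k + 1) := by
    have e1 : π * k / (n + 1) = π * (k + 1 : ℕ) / (n + 1) - π / (n + 1) := by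
      push_cast; ring
    have e2 : π * (k + 2 : ℕ) / (n + 1) = π * (k + 1 : ℕ) / (n + 1) + π / (n + 1) := by
      push_cast; ring
    simp only [hs]
    rw [e1, e2, sin_sub, sin_add]
    ring
  rw [hsum]
  have h2 : 2 * ∑ k ∈ Finset.range n, s (k + 1) * s (k + 2) =
      2 * (cos (π / (n + 1)) * ∑ k ∈ Finset.range n, sineCoeff n k ^ 2) := by
    rw [two_mul]
    nth_rewrite 1 [hshift]
    rw [← Finset.sum_add_distrib, Finset.mul_sum, Finset.mul_sum]
    refine Finset.sum_congr rfl fun k _ => ?_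
    rw [ha]
    linear_combination s (k + 1) * hrec k
  linarith

lemma sum_sq_sineCoeff_pos {n : ℕ} (hn : 1 ≤ n) :
    0 < ∑ k ∈ Finset.range n, sineCoeff n k ^ 2 := by
  refine Finset.sum_pos (fun k hk => ?_) ⟨0, Finset.mem_range.2 hn⟩
  have hk' : (k : ℝ) < n := by exact_mod_cast Finset.mem_range.1 hk
  refine pow_pos (sin_pos_of_pos_of_lt_pi (by positivity) ?_) 2
  rw [div_lt_iff₀ (by positivity)]
  exact mul_lt_mul_of_pos_left (by linarith) pi_pos

/-- The numerical constant in the first moment bound for the kernel. -/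
noncomputable def momentConst : ℝ := (π ^ 4 / 4 + 1) / 2

lemma integral_norm_mul_sq_norm_sinePoly_le (n : ℕ) :
    ∫ t, ‖t‖ * ‖sinePoly n t‖ ^ 2 ∂haarAddCircle ≤
      momentConst / (n + 1) * ∑ k ∈ Finset.range n, sineCoeff n k ^ 2 := by
  have hc := continuous_sinePoly n
  have hf : Continuous fun t : AddCircle (2 * π) => (fourier 1 t).re :=
    Complex.continuous_re.comp (map_continuous _)
  set A := ∑ k ∈ Finset.range n, sineCoeff n k ^ 2
  have hA : 0 ≤ A := Finset.sum_nonneg fun _ _ => sq_nonneg _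
  set m : ℝ := n + 1
  have hm : 0 < m := by positivity
  -- `2 ‖t‖ ≤ m ‖t‖² + 1 / m`, and `‖t‖²` is comparable to `1 - cos t`
  have hpt (t : AddCircle (2 * π)) : ‖t‖ * ‖sinePoly n t‖ ^ 2 ≤
      (m * (π ^ 2 / 2) / 2 + 1 / m / 2) * ‖sinePoly n t‖ ^ 2 -
        m * (π ^ 2 / 2) / 2 * ((fourier 1 t).re * ‖sinePoly n t‖ ^ 2) := by
    have h1 : ‖t‖ ≤ m * ‖t‖ ^ 2 / 2 + 1 / m / 2 := by
      have : 0 ≤ (m * ‖t‖ - 1) ^ 2 / m / 2 := by positivity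
      have e : (m * ‖t‖ - 1) ^ 2 / m / 2 = m * ‖t‖ ^ 2 / 2 + 1 / m / 2 - ‖t‖ := by
        field_simp
        ring
      linarith
    have h2 := mul_le_mul_of_nonneg_left (sq_norm_le_one_sub_re_fourier t) hm.le
    calc ‖t‖ * ‖sinePoly n t‖ ^ 2 ≤
        (m * (π ^ 2 / 2 * (1 - (fourier 1 t).re)) / 2 + 1 / m / 2) * ‖sinePoly n t‖ ^ 2 :=
          mul_le_mul_of_nonneg_right (by linarith) (sq_nonneg _)
      _ = _ := by ring
  have hint := integral_mono (μ := haarAddCircle) (integrable_of_continuous (by fun_prop))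
    ((integrable_of_continuous (by fun_prop)).sub (integrable_of_continuous (by fun_prop))) hpt
  refine hint.trans ?_
  simp only [Pi.sub_apply]
  rw [integral_sub (integrable_of_continuous (by fun_prop))
    (integrable_of_continuous (by fun_prop)), integral_const_mul, integral_const_mul,
    integral_sq_norm_sinePoly, integral_re_fourier_mul_sq_norm_sinePoly]
  have hcos := Real.one_sub_sq_div_two_le_cos (x := π / m)
  have h3 : m * (π ^ 2 / 2) / 2 * (1 - cos (π / m)) ≤
      m * (π ^ 2 / 2) / 2 * ((π / m) ^ 2 / 2) :=
    mul_le_mul_of_nonneg_left (by linarith) (by positivity)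
  have e : m * (π ^ 2 / 2) / 2 * ((π / m) ^ 2 / 2) + 1 / m / 2 = momentConst / m := by
    rw [momentConst]
    field_simp
    ring
  calc _ = (m * (π ^ 2 / 2) / 2 * (1 - cos (π / m)) + 1 / m / 2) * A := by ring
    _ ≤ _ := mul_le_mul_of_nonneg_right (by linarith) hA

/-- A nonnegative trigonometric polynomial of degree `< n` and mean `1` (the Fejér–Korovkin kernel)
whose first absolute moment is `O(1 / n)`. -/
lemma exists_kernel {n : ℕ} (hn : 1 ≤ n) :
    ∃ K : AddCircle (2 * π) → ℝ, Continuous K ∧ (∀ t, 0 ≤ K t) ∧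
      ∫ t, K t ∂haarAddCircle = 1 ∧ ∫ t, ‖t‖ * K t ∂haarAddCircle ≤ momentConst / (n + 1) ∧
      ∃ (s : Finset (ℕ × ℕ)) (c : ℕ × ℕ → ℂ) (m : ℕ × ℕ → ℤ), (∀ p ∈ s, |m p| ≤ n - 1) ∧
        ∀ t, (K t : ℂ) = ∑ p ∈ s, c p * fourier (m p) t := by
  have hA := sum_sq_sineCoeff_pos hn
  set A := ∑ k ∈ Finset.range n, sineCoeff n k ^ 2
  refine ⟨fun t => ‖sinePoly n t‖ ^ 2 / A, ((continuous_sinePoly n).norm.pow 2).div_const A,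
    fun t => by positivity, ?_, ?_, Finset.range n ×ˢ Finset.range n,
    fun p => ((sineCoeff n p.1 * sineCoeff n p.2 : ℝ) : ℂ) / A, fun p => p.1 - p.2, ?_, ?_⟩
  · rw [integral_div, integral_sq_norm_sinePoly, div_self hA.ne']
  · simp_rw [← mul_div_assoc]
    rw [integral_div, div_le_iff₀ hA]
    exact integral_norm_mul_sq_norm_sinePoly_le n
  · intro p hp
    simp only [Finset.mem_product, Finset.mem_range] at hp
    rw [abs_le]
    constructor <;> dsimp only <;> omega
  · intro t
    rw [Complex.ofReal_div, sq_norm_sinePoly, Finset.sum_div]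
    exact Finset.sum_congr rfl fun p _ => by ring

end Kernel

/-! ### Trigonometric polynomials on the torus -/

section TrigPoly

variable {q : ℕ} {N : ℝ}

lemma isC1_expMonomial (k : Fin q → ℤ) : IsC1 (expMonomial k) := by
  simp only [IsC1, expMonomial_proj]
  have h (j : Fin q) : ContDiff ℝ 1 fun t : Fin q → ℝ => (t j : ℂ) :=
    Complex.ofRealCLM.contDiff.comp (contDiff_apply ℝ ℝ j)
  exact (contDiff_const.mul (ContDiff.sum fun j _ => contDiff_const.mul (h j))).cexp

lemma IsC1.of_mem_trigPoly {T : Torus q → ℂ} (hT : T ∈ trigPoly q N) : IsC1 T := by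
  induction hT using Submodule.span_induction with
  | mem T h =>
    obtain ⟨k, -, rfl⟩ := h
    exact isC1_expMonomial k
  | zero => exact contDiff_const
  | add S T _ _ hS hT => exact ContDiff.add hS hT
  | smul a T _ hT => exact ContDiff.const_smul a hT

lemma finite_setOf_sqrt_lt (q : ℕ) (N : ℝ) :
    {k : Fin q → ℤ | √(∑ j, (k j : ℝ) ^ 2) < N}.Finite := by
  refine (Set.finite_Icc (fun _ : Fin q => -⌈N⌉) (fun _ => ⌈N⌉)).subset fun k hk => ?_
  have h (j : Fin q) : |k j| ≤ ⌈N⌉ := by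
    have h1 : |(k j : ℝ)| ≤ √(∑ j, (k j : ℝ) ^ 2) := Real.abs_le_sqrt
      (Finset.single_le_sum (f := fun j => (k j : ℝ) ^ 2) (fun _ _ => sq_nonneg _)
        (Finset.mem_univ j))
    have h2 : (|k j| : ℝ) ≤ ⌈N⌉ := (h1.trans (le_of_lt hk)).trans (Int.le_ceil N)
    exact_mod_cast h2
  exact ⟨fun j => (abs_le.1 (h j)).1, fun j => (abs_le.1 (h j)).2⟩

instance finiteDimensional_trigPoly (q : ℕ) (N : ℝ) : FiniteDimensional ℂ (trigPoly q N) :=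
  FiniteDimensional.span_of_finite ℂ ((finite_setOf_sqrt_lt q N).image _)

/-- Exponentials whose frequencies have all coordinates small compared with `N / √q` are in
`ℍ_N^q`. -/
lemma expMonomial_mem_trigPoly {n : ℕ} (hn : √q * (n - 1) < N) (hn1 : 1 ≤ n) {k : Fin q → ℤ}
    (hk : ∀ j, |k j| ≤ n - 1) : expMonomial k ∈ trigPoly q N := by
  refine Submodule.subset_span ⟨k, lt_of_le_of_lt ?_ hn, rfl⟩
  have hn0 : (0 : ℝ) ≤ n - 1 := sub_nonneg.2 (by exact_mod_cast hn1)
  rw [← Real.sqrt_sq hn0, ← Real.sqrt_mul (Nat.cast_nonneg q)]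
  refine Real.sqrt_le_sqrt ?_
  calc ∑ j, (k j : ℝ) ^ 2 ≤ ∑ _j : Fin q, ((n : ℝ) - 1) ^ 2 := by
        refine Finset.sum_le_sum fun j _ => ?_
        rw [← sq_abs]
        refine pow_le_pow_left₀ (abs_nonneg _) ?_ 2
        exact_mod_cast hk j
    _ = _ := by simp

lemma expMonomial_sub (k : Fin q → ℤ) (x t : Torus q) :
    expMonomial k (x - t) = expMonomial k x * expMonomial k (-t) := by
  simp only [expMonomial, ← Finset.prod_mul_distrib, Pi.sub_apply, Pi.neg_apply]
  refine Finset.prod_congr rfl fun j _ => ?_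
  simp [fourier_apply, sub_eq_add_neg, AddCircle.toCircle_add]

end TrigPoly

/-! ### Jackson approximation by convolution -/

section Jackson

open MeasureTheory AddCircle

variable {q : ℕ}

/-- The normalized Haar measure on the torus. -/
noncomputable def haar (q : ℕ) : Measure (Torus q) := Measure.pi fun _ => haarAddCircle

instance : IsProbabilityMeasure (haar q) := by unfold haar; infer_instance
instance : (haar q).IsAddHaarMeasure := by unfold haar; infer_instance
instance : (haarAddCircle (T := 2 * π)).IsNegInvariant := by unfold haarAddCircle; infer_instance
instance : (haar q).IsNegInvariant := Measure.pi.isNegInvariant _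

lemma integrable_haar_of_continuous {E : Type*} [NormedAddCommGroup E] {g : Torus q → E}
    (hg : Continuous g) : Integrable g (haar q) :=
  hg.integrable_of_hasCompactSupport (HasCompactSupport.of_compactSpace g)

/-- The tensor product kernel `∏ i, K (t i)`. -/
noncomputable def prodKernel (q : ℕ) (K : AddCircle (2 * π) → ℝ) (t : Torus q) : ℝ := ∏ i, K (t i)

/-- The convolution of `f` with the tensor product kernel, as a complex-valued function. -/
noncomputable def smooth (K : AddCircle (2 * π) → ℝ) (f : Torus q → ℝ) (x : Torus q) : ℂ :=
  ((∫ t, prodKernel q K t * f (x - t) ∂haar q : ℝ) : ℂ)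

variable {K : AddCircle (2 * π) → ℝ} {f : Torus q → ℝ}

lemma continuous_prodKernel (hK : Continuous K) : Continuous (prodKernel q K) :=
  continuous_finsetProd _ fun i _ => hK.comp (continuous_apply i)

lemma prodKernel_nonneg (hK : ∀ t, 0 ≤ K t) (t : Torus q) : 0 ≤ prodKernel q K t :=
  Finset.prod_nonneg fun _ _ => hK _

lemma integral_prodKernel (hK : ∫ t, K t ∂haarAddCircle = 1) :
    ∫ t, prodKernel q K t ∂haar q = 1 := by
  simp only [prodKernel, haar]
  rw [integral_fintype_prod_eq_prod (fun _ => K)]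
  simp [hK]

lemma integral_norm_mul_prodKernel (hK : ∫ t, K t ∂haarAddCircle = 1) (j : Fin q) :
    ∫ t, ‖t j‖ * prodKernel q K t ∂haar q = ∫ t, ‖t‖ * K t ∂haarAddCircle := by
  have h (t : Torus q) : ‖t j‖ * prodKernel q K t =
      ∏ i, (if i = j then ‖t i‖ else 1) * K (t i) := by
    rw [Finset.prod_mul_distrib, prodKernel]
    simp
  simp only [h, haar]
  rw [integral_fintype_prod_eq_prod (fun i u => (if i = j then ‖u‖ else 1) * K u),
    Finset.prod_eq_single j (fun i _ hi => by simp [hi, hK]) (by simp)]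
  simp

lemma smooth_mem_trigPoly {N : ℝ} {n : ℕ} (hn : √q * (n - 1) < N) (hn1 : 1 ≤ n)
    (hf : Continuous f) {s : Finset (ℕ × ℕ)} {c : ℕ × ℕ → ℂ} {m : ℕ × ℕ → ℤ}
    (hm : ∀ p ∈ s, |m p| ≤ n - 1) (hK : ∀ t, (K t : ℂ) = ∑ p ∈ s, c p * fourier (m p) t) :
    smooth K f ∈ trigPoly q N := by
  have hprod (t : Torus q) : (prodKernel q K t : ℂ) =
      ∑ r ∈ Fintype.piFinset fun _ : Fin q => s,
        (∏ i, c (r i)) * expMonomial (fun i => m (r i)) t := by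
    rw [prodKernel, Complex.ofReal_prod]
    simp_rw [hK, expMonomial, ← Finset.prod_mul_distrib]
    exact Finset.prod_univ_sum (fun _ => s) fun i p => c p * fourier (m p) (t i)
  have hsum : smooth K f = ∑ r ∈ Fintype.piFinset fun _ : Fin q => s,
      ((∏ i, c (r i)) * ∫ t, expMonomial (fun i => m (r i)) (-t) * f t ∂haar q) •
        expMonomial (fun i => m (r i)) := by
    ext x
    have hcont (r : Fin q → ℕ × ℕ) : Continuous fun t : Torus q => (∏ i, c (r i)) *
        expMonomial (fun i => m (r i)) (x - t) * (f t : ℂ) :=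
      (continuous_const.mul ((isC1_expMonomial _).continuous.comp
        (continuous_const.sub continuous_id))).mul (Complex.continuous_ofReal.comp hf)
    rw [smooth, ← integral_sub_left_eq_self _ (haar q) x, ← integral_complex_ofReal]
    simp only [sub_sub_cancel, Complex.ofReal_mul, hprod, Finset.sum_mul]
    rw [integral_finsetSum _ fun r _ => integrable_haar_of_continuous (hcont r), Finset.sum_apply]
    refine Finset.sum_congr rfl fun r _ => ?_
    rw [Pi.smul_apply, smul_eq_mul, mul_assoc, mul_comm (∫ _, _ ∂_), ← integral_const_mul,
      ← integral_const_mul]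
    congr 1
    ext t
    rw [expMonomial_sub]
    ring
  rw [hsum]
  refine Submodule.sum_mem _ fun r hr => Submodule.smul_mem _ _ ?_
  exact expMonomial_mem_trigPoly hn hn1 fun j => hm _ (Fintype.mem_piFinset.1 hr j)

lemma norm_sub_smooth_le (hf : IsC1 f) (hKc : Continuous K) (hK0 : ∀ t, 0 ≤ K t)
    (hK1 : ∫ t, K t ∂haarAddCircle = 1) {C : ℝ} (hC : ∫ t, ‖t‖ * K t ∂haarAddCircle ≤ C)
    (x : Torus q) : ‖(f x : ℂ) - smooth K f x‖ ≤ C * wNorm f := by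
  have hc := continuous_prodKernel (q := q) hKc
  have hfc := hf.continuous
  rw [smooth, ← Complex.ofReal_sub, Complex.norm_real, ← one_mul (f x),
    ← integral_prodKernel (q := q) hK1, ← integral_mul_const,
    ← integral_sub (integrable_haar_of_continuous (by fun_prop))
      (integrable_haar_of_continuous (by fun_prop))]
  refine (norm_integral_le_of_norm_le (g := fun t => ∑ j, supNorm (partialDeriv j f) *
    (‖t j‖ * prodKernel q K t)) (integrable_haar_of_continuous (by fun_prop))
    (Filter.Eventually.of_forall fun t => ?_)).trans ?_
  · have h := hf.norm_add_sub_le x (-t)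
    rw [← mul_sub, norm_mul, norm_sub_rev, Real.norm_of_nonneg (prodKernel_nonneg hK0 t)]
    rw [← sub_eq_add_neg] at h
    refine (mul_le_mul_of_nonneg_left h (prodKernel_nonneg hK0 t)).trans_eq ?_
    rw [Finset.mul_sum]
    refine Finset.sum_congr rfl fun j _ => ?_
    rw [Pi.neg_apply, norm_neg]
    ring
  · rw [integral_finsetSum _ fun j _ => integrable_haar_of_continuous (by fun_prop), wNorm,
      Finset.mul_sum]
    refine Finset.sum_le_sum fun j _ => ?_
    rw [integral_const_mul, integral_norm_mul_prodKernel hK1, mul_comm]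
    exact mul_le_mul_of_nonneg_right hC (supNorm_nonneg _)

lemma wNorm_smooth_le (hf : IsC1 f) (hKc : Continuous K) (hK0 : ∀ t, 0 ≤ K t)
    (hK1 : ∫ t, K t ∂haarAddCircle = 1) : wNorm (smooth K f) ≤ wNorm f := by
  have hc := continuous_prodKernel (q := q) hKc
  have hfc := hf.continuous
  refine Finset.sum_le_sum fun j _ => supNorm_partialDeriv_le (supNorm_nonneg _) fun x u => ?_
  rw [smooth, smooth, ← Complex.ofReal_sub, Complex.norm_real,
    ← integral_sub (integrable_haar_of_continuous (by fun_prop))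
      (integrable_haar_of_continuous (by fun_prop))]
  refine (norm_integral_le_of_norm_le (g := fun t => prodKernel q K t *
    (supNorm (partialDeriv j f) * ‖u‖)) (integrable_haar_of_continuous (by fun_prop))
    (Filter.Eventually.of_forall fun t => ?_)).trans_eq ?_
  · rw [← mul_sub, norm_mul, Real.norm_of_nonneg (prodKernel_nonneg hK0 t), add_sub_right_comm]
    exact mul_le_mul_of_nonneg_left (hf.norm_add_single_sub_le _ j u) (prodKernel_nonneg hK0 t)
  · rw [integral_mul_const, integral_prodKernel hK1, one_mul]

/-- A Jackson-type theorem: `ℍ_N^q` approximates a continuously differentiable `f` to order `1 / N`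
without increasing its `W^*` norm. -/
theorem exists_trigPoly_approx (hq : 1 ≤ q) (hf : IsC1 f) {N : ℝ} (hN : 0 < N) :
    ∃ T ∈ trigPoly q N, (∀ x, ‖(f x : ℂ) - T x‖ ≤ momentConst * √q * (1 / N * wNorm f)) ∧
      wNorm T ≤ wNorm f := by
  have hq0 : 0 < √(q : ℝ) := Real.sqrt_pos.2 (by exact_mod_cast hq)
  -- the largest coordinatewise degree allowed by the Euclidean bound on the frequencies
  set n : ℕ := ⌈N / √q⌉₊
  have hn1 : 1 ≤ n := Nat.one_le_ceil_iff.2 (by positivity)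
  have hle : N / √q ≤ n := Nat.le_ceil _
  have hlt : √q * ((n : ℝ) - 1) < N := by
    have := Nat.ceil_lt_add_one (show 0 ≤ N / √q by positivity)
    rw [mul_comm, ← lt_div_iff₀ hq0]
    linarith
  obtain ⟨K, hKc, hK0, hK1, hKm, s, c, m, hm, hK⟩ := exists_kernel hn1
  refine ⟨smooth K f, smooth_mem_trigPoly hlt hn1 hf.continuous hm hK, fun x => ?_,
    wNorm_smooth_le hf hKc hK0 hK1⟩
  refine (norm_sub_smooth_le hf hKc hK0 hK1 hKm x).trans ?_
  have h0 : 0 < momentConst := by unfold momentConst; positivity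
  have h : momentConst / (n + 1) ≤ momentConst * √q * (1 / N) := by
    calc momentConst / (n + 1) ≤ momentConst / (N / √q) :=
          div_le_div_of_nonneg_left h0.le (by positivity) (by linarith)
      _ = _ := by field_simp
  calc _ ≤ momentConst * √q * (1 / N) * wNorm f :=
        mul_le_mul_of_nonneg_right h (wNorm_nonneg f)
    _ = _ := by ring

end Jackson

/-! ### Existence of minimizers -/

section Minimizer

variable {q M : ℕ} {N : ℝ} {x : Fin M → Torus q} {y : Fin M → ℝ} {T : Torus q → ℂ}

lemma norm_sub_le_trainingError (x : Fin M → Torus q) (y : Fin M → ℝ) (T : Torus q → ℂ)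
    (j : Fin M) : ‖(y j : ℂ) - T (x j)‖ ≤ trainingError x y T :=
  le_ciSup (f := fun j => ‖(y j : ℂ) - T (x j)‖) (Set.finite_range _).bddAbove j

lemma trainingError_nonneg (x : Fin M → Torus q) (y : Fin M → ℝ) (T : Torus q → ℂ) :
    0 ≤ trainingError x y T :=
  Real.iSup_nonneg fun _ => norm_nonneg _

lemma trainingError_le_regFunctional (hN : 0 < N) (x : Fin M → Torus q) (y : Fin M → ℝ)
    (T : Torus q → ℂ) : trainingError x y T ≤ regFunctional x y N T :=
  le_add_of_nonneg_right (mul_nonneg (by positivity) (wNorm_nonneg T))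

lemma wNorm_le_regFunctional (hN : 0 < N) (x : Fin M → Torus q) (y : Fin M → ℝ)
    (T : Torus q → ℂ) : wNorm T ≤ N * regFunctional x y N T := by
  have h : N * (1 / N * wNorm T) = wNorm T := by field_simp
  rw [regFunctional, mul_add, h]
  exact le_add_of_nonneg_left (mul_nonneg hN.le (trainingError_nonneg x y T))

/-- Evaluation of the `j`-th partial derivative at `x`, as a linear functional on `ℍ_N^q`. -/
noncomputable def evalPartialDeriv (N : ℝ) (j : Fin q) (x : Torus q) : trigPoly q N →ₗ[ℂ] ℂ where
  toFun T := partialDeriv j T x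
  map_add' S T := by
    have hS := ((IsC1.of_mem_trigPoly S.2).hasDerivAt x j 0).differentiableAt
    have hT := ((IsC1.of_mem_trigPoly T.2).hasDerivAt x j 0).differentiableAt
    exact deriv_add hS hT
  map_smul' a T := by
    have hT := ((IsC1.of_mem_trigPoly T.2).hasDerivAt x j 0).differentiableAt
    exact deriv_const_smul a hT

/-- For the topology of pointwise convergence on `ℍ_N^q`, the functional `R_N` is lower
semicontinuous, as a supremum of continuous functions. -/
lemma lowerSemicontinuous_regFunctional (hN : 0 < N) (x : Fin M → Torus q) (y : Fin M → ℝ) :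
    LowerSemicontinuous fun T : trigPoly q N => regFunctional x y N T := by
  refine LowerSemicontinuous.add ?_ ?_
  · refine lowerSemicontinuous_ciSup (fun T => (Set.finite_range _).bddAbove) fun j => ?_
    refine Continuous.lowerSemicontinuous ?_
    exact (continuous_const.sub ((continuous_apply (x j)).comp continuous_subtype_val)).norm
  · simp only [wNorm, Finset.mul_sum]
    refine lowerSemicontinuous_sum fun j _ => ?_
    refine Continuous.comp_lowerSemicontinuous (g := fun r : ℝ => 1 / N * r) (by fun_prop) ?_
      fun a b hab => mul_le_mul_of_nonneg_left hab (by positivity)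
    refine lowerSemicontinuous_ciSup (fun T =>
      (IsC1.of_mem_trigPoly T.2).bddAbove_range_norm_partialDeriv j) fun z => ?_
    exact (LinearMap.continuous_of_finiteDimensional
      (evalPartialDeriv N j z)).norm.lowerSemicontinuous

/-- A sublevel set of `R_N` on `ℍ_N^q` is uniformly bounded: the training error controls one value,
and the `W^*` norm controls the oscillation. -/
lemma norm_le_of_regFunctional_le (hN : 0 < N) (hT : T ∈ trigPoly q N) {r : ℝ}
    (hr : regFunctional x y N T ≤ r) (j : Fin M) (z : Torus q) :
    ‖T z‖ ≤ |y j| + r + π * (N * r) := by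
  have h1 := (norm_sub_le_trainingError x y T j).trans
    ((trainingError_le_regFunctional hN x y T).trans hr)
  have h2 : ‖T z - T (x j)‖ ≤ π * (N * r) := by
    refine ((IsC1.of_mem_trigPoly hT).norm_sub_le (x j) z).trans ?_
    refine mul_le_mul ?_ ((wNorm_le_regFunctional hN x y T).trans
      (mul_le_mul_of_nonneg_left hr hN.le)) (wNorm_nonneg T) pi_pos.le
    refine (dist_pi_le_iff pi_pos.le).2 fun i => ?_
    rw [dist_eq_norm]
    refine (AddCircle.norm_le_half_period _ Real.two_pi_pos.ne').trans_eq ?_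
    rw [abs_of_pos Real.two_pi_pos]
    ring
  have h3 : T z = (y j : ℂ) - ((y j : ℂ) - T (x j)) + (T z - T (x j)) := by ring
  rw [h3]
  refine (norm_add_le _ _).trans (add_le_add ((norm_sub_le _ _).trans (add_le_add ?_ h1)) h2)
  rw [Complex.norm_real, Real.norm_eq_abs]

/-- `R_N` attains its minimum over `ℍ_N^q`. Compactness comes from Tychonoff's theorem: the
finite-dimensional space `ℍ_N^q` is closed for pointwise convergence. -/
lemma exists_isMinOn_regFunctional (hN : 0 < N) (hM : 1 ≤ M) (x : Fin M → Torus q)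
    (y : Fin M → ℝ) : ∃ T ∈ trigPoly q N,
      IsMinOn (regFunctional x y N) (trigPoly q N : Set (Torus q → ℂ)) T := by
  set r := regFunctional x y N (0 : Torus q → ℂ)
  have j : Fin M := ⟨0, hM⟩
  have hclosed : IsClosed (trigPoly q N : Set (Torus q → ℂ)) :=
    Submodule.closed_of_finiteDimensional _
  set s : Set (trigPoly q N) := Subtype.val ⁻¹'
    (Set.univ.pi fun _ : Torus q => Metric.closedBall (0 : ℂ) (|y j| + r + π * (N * r)))
  have hs : IsCompact s := hclosed.isClosedEmbedding_subtypeVal.isCompact_preimage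
    (isCompact_univ_pi fun _ => isCompact_closedBall _ _)
  have hmem {T : trigPoly q N} (hT : regFunctional x y N T ≤ r) : T ∈ s := fun z _ =>
    mem_closedBall_zero_iff.2 (norm_le_of_regFunctional_le hN T.2 hT j z)
  obtain ⟨T, -, hT⟩ := LowerSemicontinuousOn.exists_isMinOn ⟨0, hmem le_rfl⟩ hs
    ((lowerSemicontinuous_regFunctional hN x y).lowerSemicontinuousOn s)
  refine ⟨T, T.2, fun S hS => ?_⟩
  by_cases h : regFunctional x y N S ≤ r
  · exact hT (hmem (T := ⟨S, hS⟩) h)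
  · exact (hT (hmem (T := 0) le_rfl)).trans (le_of_not_ge h)

end Minimizer

end Torus

theorem theorem3p3 (q : ℕ) (hq : 1 ≤ q) :
    ∃ c : ℝ, 0 < c ∧
      ∀ (B : ℝ) (_ : 0 < B)
        (f : Torus q → ℝ) (_ : Torus.IsC1 f)
        (M : ℕ) (_ : 1 ≤ M)
        (x : Fin M → Torus q) (_ : Function.Injective x)
        (y e : Fin M → ℝ) (_ : ∀ j, y j = f (x j) + e j)
        (N : ℝ) (_ : 0 < N)
        (_ : ENNReal.ofReal B / (Set.range x).einfsep ≤ ENNReal.ofReal N),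
        (∃ T ∈ Torus.trigPoly q N,
          IsMinOn (Torus.regFunctional x y N) (Torus.trigPoly q N : Set (Torus q → ℂ)) T) ∧
        ∀ T ∈ Torus.trigPoly q N,
          IsMinOn (Torus.regFunctional x y N) (Torus.trigPoly q N : Set (Torus q → ℂ)) T →
          Torus.trainingError x y T ≤
              sInf (Torus.regFunctional x y N '' (Torus.trigPoly q N : Set (Torus q → ℂ))) ∧
          sInf (Torus.regFunctional x y N '' (Torus.trigPoly q N : Set (Torus q → ℂ))) ≤
              c * ((⨆ j, |e j|) + (1 / N) * Torus.wNorm f) ∧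
          ∀ z : Torus q,
            ‖(f z : ℂ) - T z‖ ≤
              c * (1 + N * ⨅ j, dist z (x j)) * ((⨆ j, |e j|) + (1 / N) * Torus.wNorm f) := by
  have hC : 0 < Torus.momentConst := by unfold Torus.momentConst; positivity
  set C := Torus.momentConst * √q
  have hC0 : 0 ≤ C := by positivity
  refine ⟨C + 2, by positivity, fun B _ f hf M hM x _ y e hy N hN _ =>
    ⟨Torus.exists_isMinOn_regFunctional hN hM x y, fun T hT hmin => ?_⟩⟩
  have : Nonempty (Fin M) := ⟨⟨0, hM⟩⟩
  set ε := ⨆ j, |e j|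
  have hε (j : Fin M) : |e j| ≤ ε := le_ciSup (f := fun j => |e j|) (Set.finite_range _).bddAbove j
  have hε0 : 0 ≤ ε := Real.iSup_nonneg fun _ => abs_nonneg _
  set W := 1 / N * Torus.wNorm f with hW
  have hW0 : 0 ≤ W := mul_nonneg (by positivity) (Torus.wNorm_nonneg f)
  have hNW : Torus.wNorm f = N * W := by rw [hW]; field_simp
  have hmin' : sInf (Torus.regFunctional x y N '' (Torus.trigPoly q N : Set (Torus q → ℂ))) =
      Torus.regFunctional x y N T :=
    IsLeast.csInf_eq ⟨⟨T, hT, rfl⟩, by rintro _ ⟨S, hS, rfl⟩; exact hmin hS⟩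
  rw [hmin']
  set R := Torus.regFunctional x y N T
  have hdata (j : Fin M) : ‖(y j : ℂ) - f (x j)‖ ≤ ε := by
    rw [hy j, ← Complex.ofReal_sub, Complex.norm_real, add_sub_cancel_left]
    exact hε j
  have hR : R ≤ (C + 1) * (ε + W) := by
    obtain ⟨S, hS, hSf, hSW⟩ := Torus.exists_trigPoly_approx hq hf hN
    have h1 : Torus.trainingError x y S ≤ ε + C * W := ciSup_le fun j =>
      (norm_sub_le_norm_sub_add_norm_sub _ (f (x j) : ℂ) _).trans (add_le_add (hdata j) (hSf (x j)))
    have h2 : 1 / N * Torus.wNorm S ≤ W := mul_le_mul_of_nonneg_left hSW (by positivity)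
    have h3 : R ≤ Torus.regFunctional x y N S := hmin hS
    have h4 : 0 ≤ C * ε := by positivity
    rw [Torus.regFunctional] at h3
    linarith
  have htrain := Torus.trainingError_le_regFunctional hN x y T
  refine ⟨htrain, hR.trans (mul_le_mul_of_nonneg_right (by linarith) (by positivity)), fun z => ?_⟩
  obtain ⟨j, hj⟩ := exists_eq_ciInf_of_finite (f := fun j => dist z (x j))
  rw [← hj]
  set δ := dist z (x j)
  have hδ : 0 ≤ δ := dist_nonneg
  have h1 : ‖(f z : ℂ) - f (x j)‖ ≤ δ * (N * W) := by
    rw [← Complex.ofReal_sub, Complex.norm_real, ← hNW]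
    exact hf.norm_sub_le (x j) z
  have h2 : ‖(f (x j) : ℂ) - y j‖ ≤ ε := by rw [norm_sub_rev]; exact hdata j
  have h3 : ‖(y j : ℂ) - T (x j)‖ ≤ R := (Torus.norm_sub_le_trainingError x y T j).trans htrain
  have h4 : ‖T (x j) - T z‖ ≤ δ * (N * R) := by
    rw [norm_sub_rev]
    exact ((Torus.IsC1.of_mem_trigPoly hT).norm_sub_le (x j) z).trans
      (mul_le_mul_of_nonneg_left (Torus.wNorm_le_regFunctional hN x y T) hδ)
  have h5 : (f z : ℂ) - T z =
      (f z - f (x j)) + (f (x j) - y j) + (y j - T (x j)) + (T (x j) - T z) := by ring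
  calc ‖(f z : ℂ) - T z‖ ≤ δ * (N * W) + ε + R + δ * (N * R) := by
        rw [h5]
        exact (norm_add_le _ _).trans (add_le_add ((norm_add_le _ _).trans
          (add_le_add ((norm_add_le _ _).trans (add_le_add h1 h2)) h3)) h4)
    _ ≤ (1 + N * δ) * (ε + W) + (1 + N * δ) * R := by
        have : 0 ≤ N * δ * ε := by positivity
        linarith
    _ ≤ (1 + N * δ) * (ε + W) + (1 + N * δ) * ((C + 1) * (ε + W)) := by gcongr
    _ = _ := by ring
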